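/- Let $N\ge 2$ be an integer and let $B_1^c=\{x\in\mathbb{R}^N : |x|>1\}$. Let $0<a<1$ and $\theta>0$, and put $\delta=-(N+\theta(1-a))$. Then there is a constant $C>0$, depending only on $N$, $a$ and $\theta$, such that for every real $r$ with $N<r\le \frac{N}{1-a}$ (in particular for $r=\frac{N}{1-a}$) and every real-valued $u\in C_c^\infty(B_1^c)$ (smooth, with support a compact subset of $B_1^c$), $$\left(\int_{B_1^c}|x|^{-(N+\theta)}|u|^r\,dx\right)^{\frac1r}\le C\left(\int_{B_1^c}|\nabla u|^N\,dx\right)^{\frac aN}\left(\int_{B_1^c}|x|^{-(N+\theta)}|u|^N\,dx\right)^{\frac{1-a}N}+C\left(\int_{B_1^c}|x|^{\delta}|u|^N\,dx\right)^{\frac1N}.$$ Since $a\in(0,1)$ is arbitrary, every $r\in(N,\infty)$ is covered, by taking $a\ge 1-\frac Nr$. -/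

import Mathlib

open MeasureTheory
open scoped ContDiff Gradient

/-- The exterior `{x : |x| > 1}` of the closed unit ball of `ℝ^N`. -/
def exteriorUnitBall (N : ℕ) : Set (EuclideanSpace ℝ (Fin N)) := {x | 1 < ‖x‖}

/-- `u ∈ C_c^∞(Ω)`: a smooth function (extended by zero to the whole space) whose support is
a compact subset of `Ω`. -/
structure IsTestFunction {N : ℕ} (Ω : Set (EuclideanSpace ℝ (Fin N)))
    (u : EuclideanSpace ℝ (Fin N) → ℝ) : Prop where
  smooth : ContDiff ℝ ∞ u
  compact_support : HasCompactSupport u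
  support_subset : tsupport u ⊆ Ω


/-!
Applying the `L¹` Sobolev inequality `‖v‖_{N/(N-1)} ≤ C ‖∇v‖₁` to powers of `u`, iterating, and
interpolating gives the Gagliardo–Nirenberg inequality `∫ |u|^q ≤ K (∫ |∇u|^N)^((q-N)/N) ∫ |u|^N`
for every `q ≥ N`. On a dyadic annulus of radius `R` the weight `|x|^σ` is comparable to `R^σ`, so
cutting `u` off at scale `R` yields the weighted inequality there; the gradient of the cutoff
contributes the term with weight `|x|^δ`, and `δ q = (σ + N - q) N` makes the powers of `R`
balance. Both right-hand terms are superadditive over the annuli, which overlap boundedly, so the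
inequalities can be summed. Finally `q = N / (1 - a)`, and an exponent `r` between `N` and `q` is
reached by interpolation, because `|x|^σ ≤ |x|^δ` outside the unit ball.
-/

open Module (finrank)
open scoped ENNReal NNReal

section Interpolation

variable {α : Type*} [MeasurableSpace α] {ν : Measure α} {f : α → ℝ≥0∞} {p₀ p₁ q t : ℝ}

theorem lintegral_rpow_interpolation (hf : AEMeasurable f ν) (hp₀ : 0 ≤ p₀) (hp₁ : 0 ≤ p₁)
    (ht₀ : 0 ≤ t) (ht₁ : t ≤ 1) (hq : q = (1 - t) * p₀ + t * p₁) :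
    ∫⁻ x, f x ^ q ∂ν ≤ (∫⁻ x, f x ^ p₀ ∂ν) ^ (1 - t) * (∫⁻ x, f x ^ p₁ ∂ν) ^ t := by
  have ht : 0 ≤ 1 - t := sub_nonneg.2 ht₁
  calc ∫⁻ x, f x ^ q ∂ν = ∫⁻ x, (f x ^ p₀) ^ (1 - t) * (f x ^ p₁) ^ t ∂ν := by
        simp_rw [← ENNReal.rpow_mul, hq, mul_comm _ p₀, mul_comm _ p₁]
        exact lintegral_congr fun x =>
          ENNReal.rpow_add_of_nonneg _ _ (by positivity) (by positivity)
    _ ≤ _ := ENNReal.lintegral_mul_norm_pow_le (hf.pow_const _) (hf.pow_const _) ht ht₀ (by ring)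

theorem lintegral_rpow_inv_le_add (hf : AEMeasurable f ν) (hp₀ : 0 < p₀) (hq₀ : p₀ ≤ q)
    (hq₁ : q ≤ p₁) :
    (∫⁻ x, f x ^ q ∂ν) ^ (1 / q) ≤
      (∫⁻ x, f x ^ p₀ ∂ν) ^ (1 / p₀) + (∫⁻ x, f x ^ p₁ ∂ν) ^ (1 / p₁) := by
  have hq : 0 < q := hp₀.trans_le hq₀
  have hp₁ : 0 < p₁ := hq.trans_le hq₁
  obtain ⟨s, t, hs, ht, hst, rfl⟩ : q ∈ segment ℝ p₀ p₁ := Icc_subset_segment ⟨hq₀, hq₁⟩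
  obtain rfl : s = 1 - t := by linarith
  simp only [smul_eq_mul] at hq ⊢
  set S := (∫⁻ x, f x ^ p₀ ∂ν) ^ (1 / p₀) + (∫⁻ x, f x ^ p₁ ∂ν) ^ (1 / p₁) with hS
  have h₀ : ∫⁻ x, f x ^ p₀ ∂ν ≤ S ^ p₀ := by
    rw [← ENNReal.rpow_inv_le_iff hp₀, inv_eq_one_div, hS]
    exact le_self_add
  have h₁ : ∫⁻ x, f x ^ p₁ ∂ν ≤ S ^ p₁ := by
    rw [← ENNReal.rpow_inv_le_iff hp₁, inv_eq_one_div, hS]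
    exact le_add_self
  rw [one_div, ENNReal.rpow_inv_le_iff hq]
  calc ∫⁻ x, f x ^ ((1 - t) * p₀ + t * p₁) ∂ν
      ≤ (∫⁻ x, f x ^ p₀ ∂ν) ^ (1 - t) * (∫⁻ x, f x ^ p₁ ∂ν) ^ t :=
        lintegral_rpow_interpolation hf hp₀.le hp₁.le ht (by linarith) rfl
    _ ≤ (S ^ p₀) ^ (1 - t) * (S ^ p₁) ^ t := by gcongr
    _ = S ^ ((1 - t) * p₀ + t * p₁) := by
        rw [← ENNReal.rpow_mul, ← ENNReal.rpow_mul,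
          ← ENNReal.rpow_add_of_nonneg _ _ (by positivity) (by positivity), mul_comm p₀,
          mul_comm p₁]

end Interpolation

section GagliardoNirenberg

variable {E : Type*} [NormedAddCommGroup E] [NormedSpace ℝ E]

theorem enorm_fderiv_pow {u : E → ℝ} (n : ℕ) {x : E} (hu : DifferentiableAt ℝ u x) :
    ‖fderiv ℝ (fun y => u y ^ n) x‖ₑ = n * (‖u x‖ₑ ^ (n - 1) * ‖fderiv ℝ u x‖ₑ) := by
  rw [(hu.hasFDerivAt.pow n).fderiv]
  simp [enorm_smul, enorm_mul, enorm_pow, mul_assoc]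

variable [FiniteDimensional ℝ E] [MeasurableSpace E] [BorelSpace E] (μ : Measure E)
  [μ.IsAddHaarMeasure] {N : ℕ} {p q : ℝ}

theorem exists_lintegral_rpow_succ_mul_le (hE : finrank ℝ E = N)
    (hp : (N : ℝ).HolderConjugate p) (k : ℕ) :
    ∃ K : ℝ≥0, ∀ u : E → ℝ, ContDiff ℝ 1 u → HasCompactSupport u →
      ∫⁻ x, ‖u x‖ₑ ^ ((k + 1) * p) ∂μ ≤
        K * (∫⁻ x, ‖fderiv ℝ u x‖ₑ ^ (N : ℝ) ∂μ) ^ (p - 1) * ∫⁻ x, ‖u x‖ₑ ^ (k * p) ∂μ := by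
  subst hE
  set C := lintegralPowLePowLIntegralFDerivConst μ p
  refine ⟨C * ((k + 1 : ℕ) : ℝ≥0) ^ p, fun u hu hcu => ?_⟩
  have hp₀ : 0 < p := hp.symm.pos
  have hum : Measurable fun x => ‖u x‖ₑ := hu.continuous.enorm.measurable
  have hdum : Measurable fun x => ‖fderiv ℝ u x‖ₑ :=
    (hu.continuous_fderiv one_ne_zero).enorm.measurable
  set D := ∫⁻ x, ‖fderiv ℝ u x‖ₑ ^ (finrank ℝ E : ℝ) ∂μ
  set J := ∫⁻ x, ‖u x‖ₑ ^ (k * p) ∂μ with hJ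
  have sobolev : ∫⁻ x, ‖u x ^ (k + 1)‖ₑ ^ p ∂μ ≤
      C * (∫⁻ x, ‖fderiv ℝ (fun y => u y ^ (k + 1)) x‖ₑ ∂μ) ^ p :=
    lintegral_pow_le_pow_lintegral_fderiv μ (hu.pow _)
      (hcu.comp_left (g := fun t : ℝ => t ^ (k + 1)) (by simp)) hp
  have chain_rule : ∫⁻ x, ‖fderiv ℝ (fun y => u y ^ (k + 1)) x‖ₑ ∂μ =
      (k + 1 : ℕ) * ∫⁻ x, ‖u x‖ₑ ^ k * ‖fderiv ℝ u x‖ₑ ∂μ := by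
    rw [← lintegral_const_mul _ (by fun_prop)]
    exact lintegral_congr fun x => enorm_fderiv_pow _ (hu.differentiable one_ne_zero x)
  have holder : ∫⁻ x, ‖u x‖ₑ ^ k * ‖fderiv ℝ u x‖ₑ ∂μ ≤
      J ^ (1 / p) * D ^ (1 / (finrank ℝ E : ℝ)) := by
    simp_rw [hJ, ENNReal.rpow_mul, ENNReal.rpow_natCast]
    exact ENNReal.lintegral_mul_le_Lp_mul_Lq μ hp.symm (hum.pow_const k).aemeasurable
      hdum.aemeasurable
  have exponent : 1 / (finrank ℝ E : ℝ) * p = p - 1 := by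
    rw [one_div, inv_mul_eq_div, hp.symm.div_conj_eq_sub_one]
  calc ∫⁻ x, ‖u x‖ₑ ^ ((k + 1) * p) ∂μ = ∫⁻ x, ‖u x ^ (k + 1)‖ₑ ^ p ∂μ := by
        simp_rw [enorm_pow, ← ENNReal.rpow_natCast, ← ENNReal.rpow_mul, Nat.cast_succ]
    _ ≤ C * ((k + 1 : ℕ) * (J ^ (1 / p) * D ^ (1 / (finrank ℝ E : ℝ)))) ^ p := by
        rw [chain_rule] at sobolev
        exact sobolev.trans (by gcongr)
    _ = _ := by
        rw [ENNReal.mul_rpow_of_nonneg _ _ hp₀.le, ENNReal.mul_rpow_of_nonneg _ _ hp₀.le,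
          ← ENNReal.rpow_mul, ← ENNReal.rpow_mul, one_div_mul_cancel hp₀.ne', ENNReal.rpow_one,
          exponent, ENNReal.coe_mul, ENNReal.coe_rpow_of_nonneg _ hp₀.le, ENNReal.coe_natCast]
        ring

theorem exists_lintegral_rpow_add_mul_le (hE : finrank ℝ E = N)
    (hp : (N : ℝ).HolderConjugate p) (k m : ℕ) :
    ∃ K : ℝ≥0, ∀ u : E → ℝ, ContDiff ℝ 1 u → HasCompactSupport u →
      ∫⁻ x, ‖u x‖ₑ ^ ((k + m) * p) ∂μ ≤
        K * (∫⁻ x, ‖fderiv ℝ u x‖ₑ ^ (N : ℝ) ∂μ) ^ (m * (p - 1)) *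
          ∫⁻ x, ‖u x‖ₑ ^ (k * p) ∂μ := by
  induction m with
  | zero => exact ⟨1, fun u _ _ => by simp⟩
  | succ m ih =>
    obtain ⟨K, hK⟩ := ih
    obtain ⟨L, hL⟩ := exists_lintegral_rpow_succ_mul_le μ hE hp (k + m)
    refine ⟨L * K, fun u hu hcu => ?_⟩
    have hp₁ : 0 ≤ p - 1 := hp.symm.sub_one_pos.le
    have hLu := hL u hu hcu
    push_cast at hLu ⊢
    rw [← add_assoc]
    refine hLu.trans ((mul_le_mul_right (hK u hu hcu) _).trans_eq ?_)
    rw [add_one_mul (m : ℝ), ENNReal.rpow_add_of_nonneg _ _ (by positivity) hp₁]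
    ring

theorem gagliardoNirenberg (hE : finrank ℝ E = N) (hN : 2 ≤ N) (hq : N ≤ q) :
    ∃ K : ℝ≥0, ∀ u : E → ℝ, ContDiff ℝ 1 u → HasCompactSupport u →
      ∫⁻ x, ‖u x‖ₑ ^ q ∂μ ≤
        K * (∫⁻ x, ‖fderiv ℝ u x‖ₑ ^ (N : ℝ) ∂μ) ^ ((q - N) / N) *
          ∫⁻ x, ‖u x‖ₑ ^ (N : ℝ) ∂μ := by
  have hp := Real.HolderConjugate.conjExponent (p := N) (by exact_mod_cast hN)
  set p := Real.conjExponent N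
  have hp₀ : 0 < p := hp.symm.pos
  obtain ⟨m, hm⟩ := exists_nat_gt ((q - N) / p)
  have hm₀ : (0 : ℝ) < m := (div_nonneg (sub_nonneg.2 hq) hp₀.le).trans_lt hm
  set t : ℝ := (q - N) / (m * p) with ht
  have ht₀ : 0 ≤ t := div_nonneg (sub_nonneg.2 hq) (by positivity)
  have ht₁ : t ≤ 1 := (div_le_one (by positivity)).2 ((div_lt_iff₀ hp₀).1 hm).le
  have hpN : ((N - 1 : ℕ) : ℝ) * p = N := by
    rw [Nat.cast_pred (by omega), hp.sub_one_mul_conj]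
  have hqt : q = (1 - t) * N + t * (((N - 1 : ℕ) + m) * p) := by
    rw [add_mul, hpN, ht]; field_simp; ring
  obtain ⟨K, hK⟩ := exists_lintegral_rpow_add_mul_le μ hE hp (N - 1) m
  refine ⟨K ^ t, fun u hu hcu => ?_⟩
  have hKu := hK u hu hcu
  rw [hpN] at hKu
  set D := ∫⁻ x, ‖fderiv ℝ u x‖ₑ ^ (N : ℝ) ∂μ
  set J := ∫⁻ x, ‖u x‖ₑ ^ (N : ℝ) ∂μ
  have exponent : m * (p - 1) * t = (q - N) / N := by
    rw [← hp.symm.div_conj_eq_sub_one, ht]; field_simp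
  calc ∫⁻ x, ‖u x‖ₑ ^ q ∂μ ≤ J ^ (1 - t) * (∫⁻ x, ‖u x‖ₑ ^ (((N - 1 : ℕ) + m) * p) ∂μ) ^ t :=
        lintegral_rpow_interpolation hu.continuous.enorm.aemeasurable N.cast_nonneg
          (by positivity) ht₀ ht₁ hqt
    _ ≤ J ^ (1 - t) * (K * D ^ (m * (p - 1)) * J) ^ t := by gcongr
    _ = K ^ t * D ^ ((q - N) / N) * (J ^ (1 - t) * J ^ t) := by
        rw [ENNReal.mul_rpow_of_nonneg _ _ ht₀, ENNReal.mul_rpow_of_nonneg _ _ ht₀,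
          ← ENNReal.rpow_mul, exponent]
        ring
    _ = _ := by
        rw [← ENNReal.rpow_add_of_nonneg _ _ (sub_nonneg.2 ht₁) ht₀, sub_add_cancel,
          ENNReal.rpow_one, ENNReal.coe_rpow_of_nonneg _ ht₀]

end GagliardoNirenberg

section Annulus

variable {E : Type*} [NormedAddCommGroup E]

/-- The half-open annulus `{x : a ≤ |x| < b}` centred at the origin. -/
def annulus (E : Type*) [NormedAddCommGroup E] (a b : ℝ) : Set E := norm ⁻¹' Set.Ico a b

theorem measurableSet_annulus [MeasurableSpace E] [OpensMeasurableSpace E] (a b : ℝ) :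
    MeasurableSet (annulus E a b) :=
  measurable_norm measurableSet_Ico

end Annulus

section Cutoff

variable (E : Type*) [NormedAddCommGroup E] [NormedSpace ℝ E] [FiniteDimensional ℝ E]

theorem exists_unit_annulus_cutoff :
    ∃ η : E → ℝ, ContDiff ℝ 1 η ∧ (∀ x, ‖η x‖ₑ ≤ 1) ∧ (∀ x ∈ annulus E 1 2, η x = 1) ∧
      tsupport η ⊆ annulus E (1 / 2) 4 := by
  let outer : ContDiffBump (0 : E) := ⟨2, 3, by norm_num, by norm_num⟩
  let inner : ContDiffBump (0 : E) := ⟨1 / 2, 1, by norm_num, by norm_num⟩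
  have inner_eq_zero {x : E} (hx : 1 ≤ ‖x‖) : inner x = 0 :=
    inner.zero_of_le_dist (by simpa using hx)
  refine ⟨fun x => outer x - inner x, outer.contDiff.sub inner.contDiff, fun x => ?_,
    fun x hx => ?_, ?_⟩
  · rw [Real.enorm_eq_ofReal_abs, ENNReal.ofReal_le_one]
    exact abs_sub_le_of_nonneg_of_le outer.nonneg outer.le_one inner.nonneg inner.le_one
  · simp only [inner_eq_zero hx.1, outer.one_of_mem_closedBall (by simpa using hx.2.le), sub_zero]
  · have support_subset : Function.support (fun x => outer x - inner x) ⊆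
        norm ⁻¹' Set.Icc (1 / 2) 3 := fun x hx => by
      contrapose! hx
      rcases not_and_or.1 hx with h | h <;> rw [not_le] at h <;>
        rw [Function.notMem_support]
      · rw [outer.one_of_mem_closedBall (by simpa using h.le.trans (by norm_num)),
          inner.one_of_mem_closedBall (by simpa [inner] using h.le), sub_self]
      · rw [outer.zero_of_le_dist (by simpa using h.le),
          inner_eq_zero (h.le.trans' (by norm_num)), sub_self]
    exact (closure_minimal support_subset (isClosed_Icc.preimage continuous_norm)).trans
      (Set.preimage_mono (Set.Icc_subset_Ico_right (by norm_num)))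

theorem exists_annulus_cutoff :
    ∃ M : ℝ≥0, ∀ R : ℝ, 0 < R → ∃ η : E → ℝ, ContDiff ℝ 1 η ∧ (∀ x, ‖η x‖ₑ ≤ 1) ∧
      (∀ x ∈ annulus E R (2 * R), η x = 1) ∧ tsupport η ⊆ annulus E (R / 2) (4 * R) ∧
      ∀ x, ‖fderiv ℝ η x‖ₑ ≤ M * (ENNReal.ofReal R)⁻¹ := by
  obtain ⟨η, hη, hη_le, hη_one, hη_supp⟩ := exists_unit_annulus_cutoff E
  have hcη : HasCompactSupport η := (isCompact_closedBall (0 : E) 4).of_isClosed_subset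
    (isClosed_tsupport η) fun x hx => by simpa using (hη_supp hx).2.le
  obtain ⟨C, hC⟩ := (hη.continuous_fderiv one_ne_zero).bounded_above_of_compact_support
    (hcη.fderiv ℝ)
  refine ⟨C.toNNReal, fun R hR => ?_⟩
  have mem_annulus {a b : ℝ} {x : E} :
      R⁻¹ • x ∈ annulus E a b ↔ x ∈ annulus E (a * R) (b * R) := by
    simp [annulus, norm_smul, abs_of_pos hR, inv_mul_eq_div, le_div_iff₀ hR, div_lt_iff₀ hR]
  refine ⟨fun x => η (R⁻¹ • x), by fun_prop, fun x => hη_le _, fun x hx => hη_one _ ?_,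
    fun x hx => ?_, fun x => ?_⟩
  · rwa [mem_annulus, one_mul]
  · have := mem_annulus.1 (hη_supp (tsupport_comp_subset_preimage η (continuous_const_smul R⁻¹) hx))
    rwa [one_div_mul_eq_div] at this
  · rw [fderiv_comp_smul, enorm_smul, mul_comm, ← ENNReal.ofReal_inv_of_pos hR,
      Real.enorm_of_nonneg (by positivity)]
    gcongr
    rw [← ofReal_norm]
    exact ENNReal.ofReal_le_ofReal (hC _)

end Cutoff

section Localization

variable {E : Type*} [NormedAddCommGroup E] [NormedSpace ℝ E]

theorem enorm_fderiv_mul_le {η u : E → ℝ} {x : E} (hη : DifferentiableAt ℝ η x)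
    (hu : DifferentiableAt ℝ u x) :
    ‖fderiv ℝ (fun y => η y * u y) x‖ₑ ≤
      ‖η x‖ₑ * ‖fderiv ℝ u x‖ₑ + ‖fderiv ℝ η x‖ₑ * ‖u x‖ₑ := by
  rw [fderiv_fun_mul hη hu, mul_comm ‖fderiv ℝ η x‖ₑ, ← enorm_smul, ← enorm_smul]
  exact enorm_add_le (η x • fderiv ℝ u x) (u x • fderiv ℝ η x)

variable [MeasurableSpace E] [BorelSpace E] (μ : Measure E)

theorem lintegral_fderiv_mul_rpow_le {η u : E → ℝ} {A : Set E} {c : ℝ≥0∞} {p : ℝ}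
    (hA : MeasurableSet A) (hp : 0 < p) (hη : ContDiff ℝ 1 η) (hη_le : ∀ x, ‖η x‖ₑ ≤ 1)
    (hη_supp : tsupport η ⊆ A) (hDη : ∀ x, ‖fderiv ℝ η x‖ₑ ≤ c) (hu : ContDiff ℝ 1 u) :
    ∫⁻ x, ‖fderiv ℝ (fun y => η y * u y) x‖ₑ ^ p ∂μ ≤
      2 ^ p * (∫⁻ x, ‖fderiv ℝ u x‖ₑ ^ p ∂μ + c ^ p * ∫⁻ x in A, ‖u x‖ₑ ^ p ∂μ) := by
  have hum : Measurable fun x => ‖u x‖ₑ := hu.continuous.enorm.measurable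
  have hdum : Measurable fun x => ‖fderiv ℝ u x‖ₑ :=
    (hu.continuous_fderiv one_ne_zero).enorm.measurable
  have product_rule (x : E) : ‖fderiv ℝ (fun y => η y * u y) x‖ₑ ≤
      ‖fderiv ℝ u x‖ₑ + A.indicator (fun x => c * ‖u x‖ₑ) x := by
    refine (enorm_fderiv_mul_le (hη.differentiable one_ne_zero x)
      (hu.differentiable one_ne_zero x)).trans (add_le_add (mul_le_of_le_one_left' (hη_le x)) ?_)
    by_cases hx : x ∈ A
    · rw [Set.indicator_of_mem hx]
      gcongr
      exact hDη x
    · have fderiv_eq_zero : fderiv ℝ η x = 0 := image_eq_zero_of_notMem_tsupport fun h =>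
        hx (hη_supp (tsupport_fderiv_subset ℝ h))
      simp [hx, fderiv_eq_zero, ← ofReal_norm (0 : E →L[ℝ] ℝ)]
  have indicator_rpow (x : E) : A.indicator (fun x => c * ‖u x‖ₑ) x ^ p =
      c ^ p * A.indicator (fun x => ‖u x‖ₑ ^ p) x := by
    by_cases hx : x ∈ A <;> simp [hx, hp, ENNReal.mul_rpow_of_nonneg _ _ hp.le]
  calc ∫⁻ x, ‖fderiv ℝ (fun y => η y * u y) x‖ₑ ^ p ∂μ
      ≤ ∫⁻ x, 2 ^ p * (‖fderiv ℝ u x‖ₑ ^ p +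
          c ^ p * A.indicator (fun x => ‖u x‖ₑ ^ p) x) ∂μ := by
        refine lintegral_mono fun x => (ENNReal.rpow_le_rpow (product_rule x) hp.le).trans ?_
        rw [← indicator_rpow]
        exact ENNReal.add_rpow_le_two_rpow_mul_rpow_add_rpow _ _ hp.le
    _ = _ := by
        have := (hum.pow_const p).indicator hA
        rw [lintegral_const_mul _ (by fun_prop), lintegral_add_left (hdum.pow_const p),
          lintegral_const_mul _ (by fun_prop), lintegral_indicator hA]

variable [FiniteDimensional ℝ E]

theorem exists_annulus_localization {p : ℝ} (hp : 0 < p) :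
    ∃ L : ℝ≥0, ∀ R : ℝ, 0 < R → ∀ u : E → ℝ, ContDiff ℝ 1 u → HasCompactSupport u →
      ∃ v : E → ℝ, ContDiff ℝ 1 v ∧ HasCompactSupport v ∧
        (∀ x ∈ annulus E R (2 * R), v x = u x) ∧
        (∀ x, ‖v x‖ₑ ≤ (annulus E (R / 2) (4 * R)).indicator (fun y => ‖u y‖ₑ) x) ∧
        ∫⁻ x, ‖fderiv ℝ v x‖ₑ ^ p ∂μ ≤ L * (∫⁻ x, ‖fderiv ℝ u x‖ₑ ^ p ∂μ +
          ENNReal.ofReal R ^ (-p) * ∫⁻ x in annulus E (R / 2) (4 * R), ‖u x‖ₑ ^ p ∂μ) := by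
  obtain ⟨M, hM⟩ := exists_annulus_cutoff E
  refine ⟨2 ^ p * (1 + M ^ p), fun R hR u hu hcu => ?_⟩
  obtain ⟨η, hη, hη_le, hη_one, hη_supp, hDη⟩ := hM R hR
  refine ⟨fun x => η x * u x, hη.mul hu, hcu.mul_left, fun x hx => ?_, fun x => ?_, ?_⟩
  · simp only [hη_one x hx, one_mul]
  · by_cases hx : x ∈ annulus E (R / 2) (4 * R)
    · rw [Set.indicator_of_mem hx, enorm_mul]
      exact mul_le_of_le_one_left' (hη_le x)
    · simp [image_eq_zero_of_notMem_tsupport fun h => hx (hη_supp h)]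
  · refine (lintegral_fderiv_mul_rpow_le μ (measurableSet_annulus _ _) hp hη hη_le hη_supp hDη
      hu).trans ?_
    rw [ENNReal.mul_rpow_of_nonneg _ _ hp.le, ENNReal.inv_rpow, ← ENNReal.rpow_neg, mul_assoc]
    push_cast [ENNReal.coe_rpow_of_nonneg _ hp.le]
    rw [mul_assoc, mul_add (1 + (M : ℝ≥0∞) ^ p)]
    gcongr
    · exact le_mul_of_one_le_left' le_self_add
    · exact le_add_self

variable [μ.IsAddHaarMeasure] {N : ℕ} {q : ℝ}

theorem exists_setLIntegral_annulus_rpow_le (hE : finrank ℝ E = N) (hN : 2 ≤ N) (hq : N ≤ q) :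
    ∃ K : ℝ≥0, ∀ R : ℝ, 0 < R → ∀ u : E → ℝ, ContDiff ℝ 1 u → HasCompactSupport u →
      ∫⁻ x in annulus E R (2 * R), ‖u x‖ₑ ^ q ∂μ ≤
        K * ((∫⁻ x, ‖fderiv ℝ u x‖ₑ ^ (N : ℝ) ∂μ) ^ ((q - N) / N) +
            (ENNReal.ofReal R ^ (-(N : ℝ)) *
              ∫⁻ x in annulus E (R / 2) (4 * R), ‖u x‖ₑ ^ (N : ℝ) ∂μ) ^ ((q - N) / N)) *
          ∫⁻ x in annulus E (R / 2) (4 * R), ‖u x‖ₑ ^ (N : ℝ) ∂μ := by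
  have hN₀ : 0 < (N : ℝ) := by positivity
  set s := (q - N) / N
  have hs₀ : 0 ≤ s := div_nonneg (sub_nonneg.2 hq) hN₀.le
  obtain ⟨K, hK⟩ := gagliardoNirenberg μ hE hN hq
  obtain ⟨L, hL⟩ := exists_annulus_localization μ hN₀
  refine ⟨K * (L ^ s * 2 ^ s), fun R hR u hu hcu => ?_⟩
  obtain ⟨v, hv, hcv, hvu, hv_le, hDv⟩ := hL R hR u hu hcu
  set D := ∫⁻ x, ‖fderiv ℝ u x‖ₑ ^ (N : ℝ) ∂μ
  set J := ∫⁻ x in annulus E (R / 2) (4 * R), ‖u x‖ₑ ^ (N : ℝ) ∂μ with hJ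
  have hvJ : ∫⁻ x, ‖v x‖ₑ ^ (N : ℝ) ∂μ ≤ J := by
    rw [hJ, ← lintegral_indicator (measurableSet_annulus _ _)]
    refine lintegral_mono fun x => (ENNReal.rpow_le_rpow (hv_le x) hN₀.le).trans_eq ?_
    by_cases hx : x ∈ annulus E (R / 2) (4 * R) <;> simp [hx, show N ≠ 0 by omega]
  calc ∫⁻ x in annulus E R (2 * R), ‖u x‖ₑ ^ q ∂μ
      = ∫⁻ x in annulus E R (2 * R), ‖v x‖ₑ ^ q ∂μ :=
        setLIntegral_congr_fun (measurableSet_annulus _ _) fun x hx => by rw [hvu x hx]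
    _ ≤ ∫⁻ x, ‖v x‖ₑ ^ q ∂μ := setLIntegral_le_lintegral _ _
    _ ≤ K * (∫⁻ x, ‖fderiv ℝ v x‖ₑ ^ (N : ℝ) ∂μ) ^ s * ∫⁻ x, ‖v x‖ₑ ^ (N : ℝ) ∂μ := hK v hv hcv
    _ ≤ K * (L * (D + ENNReal.ofReal R ^ (-(N : ℝ)) * J)) ^ s * J := by gcongr
    _ ≤ K * (L ^ s * (2 ^ s * (D ^ s + (ENNReal.ofReal R ^ (-(N : ℝ)) * J) ^ s))) * J := by
        rw [ENNReal.mul_rpow_of_nonneg _ _ hs₀]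
        gcongr
        exact ENNReal.add_rpow_le_two_rpow_mul_rpow_add_rpow _ _ hs₀
    _ = _ := by
        push_cast [ENNReal.coe_rpow_of_nonneg _ hs₀]
        ring

end Localization

section DyadicSummation

variable {E : Type*} [NormedAddCommGroup E]

theorem iUnion_annulus_two_zpow :
    ⋃ k : ℤ, annulus E ((2 : ℝ) ^ k) ((2 : ℝ) ^ (k + 1)) = {0}ᶜ := by
  ext x
  simp only [Set.mem_iUnion, Set.mem_compl_iff, Set.mem_singleton_iff]
  constructor
  · rintro ⟨k, hk⟩ rfl
    have : (2 : ℝ) ^ k ≤ 0 := by simpa using hk.1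
    exact this.not_gt (by positivity)
  · exact fun hx => exists_mem_Ico_zpow (norm_pos_iff.2 hx) one_lt_two

theorem pairwise_disjoint_annulus_two_zpow :
    Pairwise (Function.onFun Disjoint fun k : ℤ =>
      annulus E ((2 : ℝ) ^ k) ((2 : ℝ) ^ (k + 1))) := fun _ _ h =>
  ((zpow_right_mono₀ (one_le_two (α := ℝ))).pairwise_disjoint_on_Ico_succ h).preimage norm

variable [MeasurableSpace E] [OpensMeasurableSpace E] (ν : Measure E) [NullSingletonClass ν]

theorem lintegral_eq_tsum_annulus (f : E → ℝ≥0∞) :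
    ∫⁻ x, f x ∂ν = ∑' k : ℤ, ∫⁻ x in annulus E ((2 : ℝ) ^ k) ((2 : ℝ) ^ (k + 1)), f x ∂ν := by
  rw [← lintegral_iUnion (fun _ => measurableSet_annulus _ _) pairwise_disjoint_annulus_two_zpow,
    iUnion_annulus_two_zpow, restrict_compl_singleton]

theorem tsum_lintegral_enlarged_annulus_le (f : E → ℝ≥0∞) :
    ∑' k : ℤ, ∫⁻ x in annulus E ((2 : ℝ) ^ k / 2) (4 * (2 : ℝ) ^ k), f x ∂ν ≤
      3 * ∫⁻ x, f x ∂ν := by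
  set I : ℤ → ℝ≥0∞ := fun k => ∫⁻ x in annulus E ((2 : ℝ) ^ k) ((2 : ℝ) ^ (k + 1)), f x ∂ν
  have le_three (k : ℤ) : ∫⁻ x in annulus E ((2 : ℝ) ^ k / 2) (4 * (2 : ℝ) ^ k), f x ∂ν ≤
      I (k + -1) + I k + I (k + 1) := by
    have subset_union : annulus E ((2 : ℝ) ^ k / 2) (4 * (2 : ℝ) ^ k) ⊆
        annulus E ((2 : ℝ) ^ (k + -1)) ((2 : ℝ) ^ (k + -1 + 1)) ∪
          annulus E ((2 : ℝ) ^ k) ((2 : ℝ) ^ (k + 1)) ∪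
            annulus E ((2 : ℝ) ^ (k + 1)) ((2 : ℝ) ^ (k + 1 + 1)) := by
      have lower : (2 : ℝ) ^ (k + -1) = 2 ^ k / 2 := zpow_sub_one₀ two_ne_zero k
      have upper : (2 : ℝ) ^ (k + 1 + 1) = 4 * 2 ^ k := by
        rw [zpow_add_one₀ two_ne_zero, zpow_add_one₀ two_ne_zero]; ring
      rw [lower, upper, neg_add_cancel_right]
      simp only [annulus, ← Set.preimage_union]
      exact Set.preimage_mono (Set.Ico_subset_Ico_union_Ico.trans
        (Set.union_subset_union_left _ Set.Ico_subset_Ico_union_Ico))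
    exact (lintegral_mono_set subset_union).trans ((lintegral_union_le _ _ _).trans
      (add_le_add_left (lintegral_union_le _ _ _) _))
  have tsum_shift (c : ℤ) : ∑' k, I (k + c) = ∑' k, I k := (Equiv.addRight c).tsum_eq I
  calc _ ≤ ∑' k, (I (k + -1) + I k + I (k + 1)) := ENNReal.tsum_le_tsum le_three
    _ = 3 * ∑' k, I k := by
        rw [ENNReal.tsum_add, ENNReal.tsum_add, tsum_shift, tsum_shift]; ring
    _ = _ := by rw [lintegral_eq_tsum_annulus ν f]

end DyadicSummation

section PowerWeight

theorem rpow_le_mul_rpow_of_comparable {c y z : ℝ≥0∞} (hc₀ : c ≠ 0) (hc : c ≠ ⊤)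
    (hyz : y ≤ c * z) (hzy : z ≤ c * y) (s : ℝ) : y ^ s ≤ c ^ |s| * z ^ s := by
  rcases le_total 0 s with hs | hs
  · rw [abs_of_nonneg hs, ← ENNReal.mul_rpow_of_nonneg _ _ hs]
    gcongr
  · obtain ⟨t, rfl⟩ : ∃ t, s = -t := ⟨-s, (neg_neg s).symm⟩
    have ht : 0 ≤ t := neg_nonpos.1 hs
    rw [abs_neg, abs_of_nonneg ht, ENNReal.rpow_neg, ENNReal.rpow_neg]
    have hzy_t : z ^ t ≤ c ^ t * y ^ t := by
      rw [← ENNReal.mul_rpow_of_nonneg _ _ ht]; gcongr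
    calc (y ^ t)⁻¹ ≤ (z ^ t / c ^ t)⁻¹ := ENNReal.inv_le_inv.2 (ENNReal.div_le_of_le_mul' hzy_t)
      _ = c ^ t * (z ^ t)⁻¹ := ENNReal.inv_div
        (Or.inl (ENNReal.rpow_ne_top_of_nonneg ht hc))
        (Or.inl (ENNReal.rpow_pos (pos_iff_ne_zero.2 hc₀) hc).ne')

variable {E : Type*} [NormedAddCommGroup E] {R : ℝ} {x : E}

theorem enorm_rpow_comparable_of_mem_annulus (hx : x ∈ annulus E (R / 2) (4 * R)) (σ : ℝ) :
    ‖x‖ₑ ^ σ ≤ 4 ^ |σ| * ENNReal.ofReal R ^ σ ∧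
      ENNReal.ofReal R ^ σ ≤ 4 ^ |σ| * ‖x‖ₑ ^ σ := by
  have ofReal_four_mul {t : ℝ} : (4 : ℝ≥0∞) * ENNReal.ofReal t = ENNReal.ofReal (4 * t) := by
    rw [ENNReal.ofReal_mul (by norm_num), ENNReal.ofReal_ofNat]
  have upper : ‖x‖ₑ ≤ 4 * ENNReal.ofReal R := by
    rw [← ofReal_norm, ofReal_four_mul]
    exact ENNReal.ofReal_le_ofReal hx.2.le
  have lower : ENNReal.ofReal R ≤ 4 * ‖x‖ₑ := by
    rw [← ofReal_norm, ofReal_four_mul]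
    exact ENNReal.ofReal_le_ofReal (by linarith [hx.1, norm_nonneg x])
  exact ⟨rpow_le_mul_rpow_of_comparable (by simp) (by simp) upper lower σ,
    rpow_le_mul_rpow_of_comparable (by simp) (by simp) lower upper σ⟩

variable [MeasurableSpace E]

/-- The measure `|x| ^ σ dμ(x)`. At the origin the density is `∞` when `σ < 0`. -/
noncomputable def powerWeight (μ : Measure E) (σ : ℝ) : Measure E :=
  μ.withDensity fun x => ‖x‖ₑ ^ σ

theorem powerWeight_zero (μ : Measure E) : powerWeight μ 0 = μ := by
  simp [powerWeight]

theorem nullSingletonClass_powerWeight (μ : Measure E) [NullSingletonClass μ] (σ : ℝ) :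
    NullSingletonClass (powerWeight μ σ) :=
  ⟨fun x => withDensity_absolutelyContinuous _ _ (measure_singleton x)⟩

variable [OpensMeasurableSpace E] {μ : Measure E} {f : E → ℝ≥0∞} {A : Set E}

theorem setLIntegral_powerWeight (σ : ℝ) (hf : Measurable f) (hA : MeasurableSet A) :
    ∫⁻ x in A, f x ∂powerWeight μ σ = ∫⁻ x in A, ‖x‖ₑ ^ σ * f x ∂μ :=
  setLIntegral_withDensity_eq_setLIntegral_mul _ (by fun_prop) hf hA

theorem setLIntegral_powerWeight_le_rpow_mul (hA : MeasurableSet A)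
    (hAR : A ⊆ annulus E (R / 2) (4 * R)) (σ : ℝ) (hf : Measurable f) :
    ∫⁻ x in A, f x ∂powerWeight μ σ ≤ 4 ^ |σ| * (ENNReal.ofReal R ^ σ * ∫⁻ x in A, f x ∂μ) := by
  rw [setLIntegral_powerWeight σ hf hA, ← mul_assoc, ← lintegral_const_mul _ hf]
  refine setLIntegral_mono' hA fun x hx => ?_
  gcongr
  exact (enorm_rpow_comparable_of_mem_annulus (hAR hx) σ).1

theorem rpow_mul_setLIntegral_le_powerWeight (hA : MeasurableSet A)
    (hAR : A ⊆ annulus E (R / 2) (4 * R)) (σ : ℝ) (hf : Measurable f) :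
    ENNReal.ofReal R ^ σ * ∫⁻ x in A, f x ∂μ ≤ 4 ^ |σ| * ∫⁻ x in A, f x ∂powerWeight μ σ := by
  rw [setLIntegral_powerWeight σ hf hA, ← lintegral_const_mul _ hf,
    ← lintegral_const_mul _ (by fun_prop)]
  refine setLIntegral_mono' hA fun x hx => ?_
  rw [← mul_assoc]
  gcongr
  exact (enorm_rpow_comparable_of_mem_annulus (hAR hx) σ).2

end PowerWeight

section WeightedGagliardoNirenberg

theorem rpow_mul_scaling {ρ : ℝ≥0∞} {n q σ δ : ℝ} (hρ₀ : ρ ≠ 0) (hρ : ρ ≠ ⊤) (J : ℝ≥0∞)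
    (hn : 0 < n) (hq : n ≤ q) (hδ : δ * q = (σ + n - q) * n) :
    ρ ^ σ * ((ρ ^ (-n) * J) ^ ((q - n) / n) * J) = (ρ ^ δ * J) ^ (q / n) := by
  have hs : 0 ≤ (q - n) / n := div_nonneg (sub_nonneg.2 hq) hn.le
  have hqn : 0 ≤ q / n := div_nonneg (hn.le.trans hq) hn.le
  have rho_exponent : δ * (q / n) = σ + -n * ((q - n) / n) := by
    rw [← mul_div_assoc, hδ]; field_simp; ring
  have mass_exponent : q / n = (q - n) / n + 1 := by field_simp; ring
  rw [ENNReal.mul_rpow_of_nonneg _ _ hs, ENNReal.mul_rpow_of_nonneg _ _ hqn,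
    ← ENNReal.rpow_mul, ← ENNReal.rpow_mul, rho_exponent, mass_exponent,
    ENNReal.rpow_add_of_nonneg _ _ hs zero_le_one, ENNReal.rpow_one, ENNReal.rpow_add _ _ hρ₀ hρ]
  ring

variable {E : Type*} [NormedAddCommGroup E] [NormedSpace ℝ E] [FiniteDimensional ℝ E]
  [MeasurableSpace E] [BorelSpace E] (μ : Measure E) [μ.IsAddHaarMeasure] {N : ℕ} {q σ δ : ℝ}

theorem exists_setLIntegral_annulus_powerWeight_le (hE : finrank ℝ E = N) (hN : 2 ≤ N)
    (hq : N ≤ q) (hδ : δ * q = (σ + N - q) * N) :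
    ∃ K : ℝ≥0, ∀ R : ℝ, 0 < R → ∀ u : E → ℝ, ContDiff ℝ 1 u → HasCompactSupport u →
      ∫⁻ x in annulus E R (2 * R), ‖u x‖ₑ ^ q ∂powerWeight μ σ ≤
        K * ((∫⁻ x, ‖fderiv ℝ u x‖ₑ ^ (N : ℝ) ∂μ) ^ ((q - N) / N) *
            (∫⁻ x in annulus E (R / 2) (4 * R), ‖u x‖ₑ ^ (N : ℝ) ∂powerWeight μ σ) +
          (∫⁻ x in annulus E (R / 2) (4 * R), ‖u x‖ₑ ^ (N : ℝ) ∂powerWeight μ δ) ^ (q / N)) := by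
  have hN₀ : 0 < (N : ℝ) := by positivity
  have hqN : 0 ≤ q / N := div_nonneg (hN₀.le.trans hq) hN₀.le
  set s := (q - N) / N
  obtain ⟨K, hK⟩ := exists_setLIntegral_annulus_rpow_le μ hE hN hq
  refine ⟨4 ^ |σ| * K * (4 ^ |σ| + (4 ^ |δ|) ^ (q / N)), fun R hR u hu hcu => ?_⟩
  have hum : Measurable fun x => ‖u x‖ₑ := hu.continuous.enorm.measurable
  have unweighted := hK R hR u hu hcu
  have insert_weight := setLIntegral_powerWeight_le_rpow_mul (μ := μ) (R := R)
    (measurableSet_annulus R (2 * R))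
    (Set.preimage_mono (Set.Ico_subset_Ico (by linarith) (by linarith))) σ (hum.pow_const q)
  have compare (τ : ℝ) := rpow_mul_setLIntegral_le_powerWeight (μ := μ) (R := R)
    (measurableSet_annulus _ _) subset_rfl τ (hum.pow_const (N : ℝ))
  have hB := compare σ
  have hF := compare δ
  set D := ∫⁻ x, ‖fderiv ℝ u x‖ₑ ^ (N : ℝ) ∂μ
  set J := ∫⁻ x in annulus E (R / 2) (4 * R), ‖u x‖ₑ ^ (N : ℝ) ∂μ
  set B := ∫⁻ x in annulus E (R / 2) (4 * R), ‖u x‖ₑ ^ (N : ℝ) ∂powerWeight μ σ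
  set F := ∫⁻ x in annulus E (R / 2) (4 * R), ‖u x‖ₑ ^ (N : ℝ) ∂powerWeight μ δ
  set ρ := ENNReal.ofReal R with hρ
  have scaling : ρ ^ σ * ((ρ ^ (-(N : ℝ)) * J) ^ s * J) = (ρ ^ δ * J) ^ (q / N) :=
    rpow_mul_scaling (by simpa [hρ] using hR) ENNReal.ofReal_ne_top J hN₀ hq hδ
  calc _ ≤ 4 ^ |σ| * (ρ ^ σ * (K * (D ^ s + (ρ ^ (-(N : ℝ)) * J) ^ s) * J)) :=
        insert_weight.trans (by gcongr)
    _ = 4 ^ |σ| * K * (D ^ s * (ρ ^ σ * J) + (ρ ^ δ * J) ^ (q / N)) := by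
        rw [← scaling]; ring
    _ ≤ 4 ^ |σ| * K * (D ^ s * (4 ^ |σ| * B) + (4 ^ |δ| * F) ^ (q / N)) := by gcongr
    _ ≤ 4 ^ |σ| * K * ((4 ^ |σ| + (4 ^ |δ|) ^ (q / N)) * (D ^ s * B + F ^ (q / N))) := by
        gcongr
        rw [ENNReal.mul_rpow_of_nonneg _ _ hqN, add_mul, mul_left_comm]
        gcongr
        · exact le_self_add
        · exact le_add_self
    _ = _ := by
        push_cast [ENNReal.coe_rpow_of_nonneg _ hqN, ENNReal.coe_rpow_of_nonneg _ (abs_nonneg σ),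
          ENNReal.coe_rpow_of_nonneg _ (abs_nonneg δ)]
        ring

theorem exists_lintegral_powerWeight_rpow_le (hE : finrank ℝ E = N) (hN : 2 ≤ N)
    (hq : N ≤ q) (hδ : δ * q = (σ + N - q) * N) :
    ∃ K : ℝ≥0, ∀ u : E → ℝ, ContDiff ℝ 1 u → HasCompactSupport u →
      ∫⁻ x, ‖u x‖ₑ ^ q ∂powerWeight μ σ ≤
        K * ((∫⁻ x, ‖fderiv ℝ u x‖ₑ ^ (N : ℝ) ∂μ) ^ ((q - N) / N) *
            (∫⁻ x, ‖u x‖ₑ ^ (N : ℝ) ∂powerWeight μ σ) +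
          (∫⁻ x, ‖u x‖ₑ ^ (N : ℝ) ∂powerWeight μ δ) ^ (q / N)) := by
  have hN₀ : 0 < (N : ℝ) := by positivity
  have : Nontrivial E := Module.nontrivial_of_finrank_pos (R := ℝ) (by omega)
  have (τ : ℝ) : NullSingletonClass (powerWeight μ τ) := nullSingletonClass_powerWeight μ τ
  set s := (q - N) / N with hs
  have hs₀ : 0 ≤ s := div_nonneg (sub_nonneg.2 hq) hN₀.le
  have rpow_split (y : ℝ≥0∞) : y ^ (q / N) = y ^ s * y := by
    rw [show q / N = s + 1 by rw [hs]; field_simp; ring,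
      ENNReal.rpow_add_of_nonneg _ _ hs₀ zero_le_one, ENNReal.rpow_one]
  obtain ⟨K, hK⟩ := exists_setLIntegral_annulus_powerWeight_le μ hE hN hq hδ
  refine ⟨K * 3, fun u hu hcu => ?_⟩
  set D := ∫⁻ x, ‖fderiv ℝ u x‖ₑ ^ (N : ℝ) ∂μ
  set B := ∫⁻ x, ‖u x‖ₑ ^ (N : ℝ) ∂powerWeight μ σ
  set F := ∫⁻ x, ‖u x‖ₑ ^ (N : ℝ) ∂powerWeight μ δ
  set b : ℤ → ℝ≥0∞ := fun k => ∫⁻ x in annulus E ((2 : ℝ) ^ k / 2) (4 * (2 : ℝ) ^ k),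
    ‖u x‖ₑ ^ (N : ℝ) ∂powerWeight μ σ
  set f : ℤ → ℝ≥0∞ := fun k => ∫⁻ x in annulus E ((2 : ℝ) ^ k / 2) (4 * (2 : ℝ) ^ k),
    ‖u x‖ₑ ^ (N : ℝ) ∂powerWeight μ δ
  have annulus_bound (k : ℤ) :
      ∫⁻ x in annulus E ((2 : ℝ) ^ k) ((2 : ℝ) ^ (k + 1)), ‖u x‖ₑ ^ q ∂powerWeight μ σ ≤
        K * (D ^ s * b k + F ^ s * f k) := by
    rw [zpow_add_one₀ two_ne_zero, mul_comm _ 2]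
    refine (hK _ (by positivity) u hu hcu).trans ?_
    rw [rpow_split]
    gcongr
    exact setLIntegral_le_lintegral _ _
  calc _ = ∑' k : ℤ, ∫⁻ x in annulus E ((2 : ℝ) ^ k) ((2 : ℝ) ^ (k + 1)),
        ‖u x‖ₑ ^ q ∂powerWeight μ σ := lintegral_eq_tsum_annulus _ _
    _ ≤ ∑' k, K * (D ^ s * b k + F ^ s * f k) := ENNReal.tsum_le_tsum annulus_bound
    _ = K * (D ^ s * ∑' k, b k + F ^ s * ∑' k, f k) := by
        rw [ENNReal.tsum_mul_left, ENNReal.tsum_add, ENNReal.tsum_mul_left, ENNReal.tsum_mul_left]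
    _ ≤ K * (D ^ s * (3 * B) + F ^ s * (3 * F)) := by
        gcongr <;> exact tsum_lintegral_enlarged_annulus_le _ _
    _ = _ := by rw [rpow_split]; push_cast; ring

theorem exists_lintegral_powerWeight_rpow_inv_le (hE : finrank ℝ E = N) (hN : 2 ≤ N)
    {a : ℝ} (ha₀ : 0 ≤ a) (ha₁ : a < 1) (θ : ℝ) :
    ∃ K : ℝ≥0, ∀ u : E → ℝ, ContDiff ℝ 1 u → HasCompactSupport u →
      (∫⁻ x, ‖u x‖ₑ ^ (N / (1 - a)) ∂powerWeight μ (-(N + θ))) ^ (1 / (N / (1 - a))) ≤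
        K * ((∫⁻ x, ‖fderiv ℝ u x‖ₑ ^ (N : ℝ) ∂μ) ^ (a / N) *
            (∫⁻ x, ‖u x‖ₑ ^ (N : ℝ) ∂powerWeight μ (-(N + θ))) ^ ((1 - a) / N) +
          (∫⁻ x, ‖u x‖ₑ ^ (N : ℝ) ∂powerWeight μ (-(N + θ * (1 - a)))) ^ (1 / (N : ℝ))) := by
  have hN₁ : 1 ≤ (N : ℝ) := by exact_mod_cast (by omega : 1 ≤ N)
  have hN₀ : 0 < (N : ℝ) := by positivity
  have ha : 0 < 1 - a := sub_pos.2 ha₁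
  set q : ℝ := N / (1 - a) with hq
  have hqN : N ≤ q := (le_div_iff₀ ha).2 (by nlinarith)
  have hq₀ : 0 ≤ 1 / q := by positivity
  have hq₁ : 1 / q ≤ 1 := div_le_one_of_le₀ (hN₁.trans hqN) (hN₀.trans_le hqN).le
  have gradient_exponent : (q - N) / N * (1 / q) = a / N := by rw [hq]; field_simp; ring
  have mass_exponent : 1 / q = (1 - a) / N := by rw [hq]; field_simp
  have weight_exponent : q / N * (1 / q) = 1 / N := by rw [hq]; field_simp
  obtain ⟨K, hK⟩ := exists_lintegral_powerWeight_rpow_le μ (q := q) (σ := -(N + θ))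
    (δ := -(N + θ * (1 - a))) hE hN hqN (by rw [hq]; field_simp; ring)
  refine ⟨K ^ (1 / q), fun u hu hcu => (ENNReal.rpow_le_rpow (hK u hu hcu) hq₀).trans ?_⟩
  rw [ENNReal.mul_rpow_of_nonneg _ _ hq₀, ENNReal.coe_rpow_of_nonneg _ hq₀]
  gcongr
  refine (ENNReal.rpow_add_le_add_rpow _ _ hq₀ hq₁).trans_eq ?_
  rw [ENNReal.mul_rpow_of_nonneg _ _ hq₀, ← ENNReal.rpow_mul, ← ENNReal.rpow_mul,
    gradient_exponent, weight_exponent, mass_exponent]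

end WeightedGagliardoNirenberg

section Exterior

theorem support_enorm_rpow_subset {α F : Type*} [NormedAddCommGroup F] {p : ℝ} (hp : 0 < p)
    {f : α → F} {A : Set α} (hf_supp : f.support ⊆ A) :
    (fun x => ‖f x‖ₑ ^ p).support ⊆ A := fun x hx => hf_supp fun hfx => hx (by simp [hfx, hp])

variable {E F : Type*} [NormedAddCommGroup E] [MeasurableSpace E] [BorelSpace E]
  [NormedAddCommGroup F] {μ : Measure E} {σ δ p : ℝ}

theorem measurableSet_one_lt_norm : MeasurableSet {x : E | 1 < ‖x‖} :=
  measurableSet_lt measurable_const measurable_norm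

theorem lintegral_powerWeight_exterior (σ : ℝ) {f : E → ℝ≥0∞} (hf : Measurable f)
    (hf_supp : f.support ⊆ {x | 1 < ‖x‖}) :
    ∫⁻ x, f x ∂powerWeight μ σ = ∫⁻ x in {x | 1 < ‖x‖}, ‖x‖ₑ ^ σ * f x ∂μ := by
  rw [← setLIntegral_powerWeight σ hf measurableSet_one_lt_norm,
    setLIntegral_eq_of_support_subset hf_supp]

theorem lintegral_powerWeight_exterior_mono (hσδ : σ ≤ δ) {f : E → ℝ≥0∞} (hf : Measurable f)
    (hf_supp : f.support ⊆ {x | 1 < ‖x‖}) :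
    ∫⁻ x, f x ∂powerWeight μ σ ≤ ∫⁻ x, f x ∂powerWeight μ δ := by
  rw [lintegral_powerWeight_exterior σ hf hf_supp, lintegral_powerWeight_exterior δ hf hf_supp]
  refine setLIntegral_mono' measurableSet_one_lt_norm fun x (hx : 1 < ‖x‖) => ?_
  gcongr
  rw [← ofReal_norm, ENNReal.one_le_ofReal]
  exact hx.le

theorem lintegral_powerWeight_exterior_ne_top [IsFiniteMeasureOnCompacts μ] (hσ : σ ≤ 0)
    (hp : 0 < p) {f : E → F} (hf : Continuous f) (hcf : HasCompactSupport f)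
    (hf_supp : f.support ⊆ {x | 1 < ‖x‖}) :
    ∫⁻ x, ‖f x‖ₑ ^ p ∂powerWeight μ σ ≠ ⊤ := by
  have memLp : MemLp f (ENNReal.ofReal p) μ := hf.memLp_of_hasCompactSupport hcf
  have finite := lintegral_rpow_enorm_lt_top_of_eLpNorm_lt_top (by simpa using hp)
    ENNReal.ofReal_ne_top memLp.2
  rw [ENNReal.toReal_ofReal hp.le] at finite
  refine ((lintegral_powerWeight_exterior_mono hσ (hf.enorm.measurable.pow_const p)
    (support_enorm_rpow_subset hp hf_supp)).trans_lt ?_).ne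
  rwa [powerWeight_zero]

theorem setIntegral_exterior_rpow_mul (σ : ℝ) (hp : 0 < p) {f : E → F} (hf : Continuous f)
    (hf_supp : f.support ⊆ {x | 1 < ‖x‖}) :
    ∫ x in {x | 1 < ‖x‖}, ‖x‖ ^ σ * ‖f x‖ ^ p ∂μ =
      (∫⁻ x, ‖f x‖ₑ ^ p ∂powerWeight μ σ).toReal := by
  have := hf.norm.measurable
  rw [integral_eq_lintegral_of_nonneg_ae (.of_forall fun x => by positivity)
    (Measurable.aestronglyMeasurable (by fun_prop)),
    lintegral_powerWeight_exterior σ (hf.enorm.measurable.pow_const p)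
      (support_enorm_rpow_subset hp hf_supp)]
  congr 1
  refine setLIntegral_congr_fun measurableSet_one_lt_norm fun x (hx : 1 < ‖x‖) => ?_
  rw [ENNReal.ofReal_mul (by positivity), ← ENNReal.ofReal_rpow_of_pos (one_pos.trans hx),
    ← ENNReal.ofReal_rpow_of_nonneg (norm_nonneg _) hp.le, ofReal_norm, ofReal_norm]

variable [NormedSpace ℝ E] [FiniteDimensional ℝ E] (μ) [μ.IsAddHaarMeasure] {N : ℕ} {a θ : ℝ}

theorem exists_exterior_lintegral_rpow_inv_le (hE : finrank ℝ E = N) (hN : 2 ≤ N)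
    (ha₀ : 0 ≤ a) (ha₁ : a < 1) (hθ : 0 ≤ θ) :
    ∃ K : ℝ≥0, 0 < K ∧ ∀ r : ℝ, N ≤ r → r ≤ N / (1 - a) → ∀ u : E → ℝ, ContDiff ℝ 1 u →
      HasCompactSupport u → u.support ⊆ {x | 1 < ‖x‖} →
      (∫⁻ x, ‖u x‖ₑ ^ r ∂powerWeight μ (-(N + θ))) ^ (1 / r) ≤
        K * ((∫⁻ x, ‖fderiv ℝ u x‖ₑ ^ (N : ℝ) ∂μ) ^ (a / N) *
            (∫⁻ x, ‖u x‖ₑ ^ (N : ℝ) ∂powerWeight μ (-(N + θ))) ^ ((1 - a) / N) +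
          (∫⁻ x, ‖u x‖ₑ ^ (N : ℝ) ∂powerWeight μ (-(N + θ * (1 - a)))) ^ (1 / (N : ℝ))) := by
  have hN₀ : 0 < (N : ℝ) := by positivity
  obtain ⟨K, hK⟩ := exists_lintegral_powerWeight_rpow_inv_le μ hE hN ha₀ ha₁ θ
  refine ⟨1 + K, by positivity, fun r hNr hr u hu hcu hu_supp => ?_⟩
  have hum : Measurable fun x => ‖u x‖ₑ := hu.continuous.enorm.measurable
  have weight_mono : ∫⁻ x, ‖u x‖ₑ ^ (N : ℝ) ∂powerWeight μ (-(N + θ)) ≤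
      ∫⁻ x, ‖u x‖ₑ ^ (N : ℝ) ∂powerWeight μ (-(N + θ * (1 - a))) :=
    lintegral_powerWeight_exterior_mono (by nlinarith) (hum.pow_const _)
      (support_enorm_rpow_subset hN₀ hu_supp)
  refine (lintegral_rpow_inv_le_add hum.aemeasurable hN₀ hNr hr).trans ?_
  rw [ENNReal.coe_add, ENNReal.coe_one, one_add_mul]
  refine add_le_add (le_add_left ?_) (hK u hu hcu)
  gcongr

theorem toReal_le_mul_rpow_add_of_le {A D B F : ℝ≥0∞} {K : ℝ≥0} {α β γ κ : ℝ} (hα : 0 ≤ α)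
    (hβ : 0 ≤ β) (hγ : 0 ≤ γ) (hD : D ≠ ⊤) (hB : B ≠ ⊤) (hF : F ≠ ⊤)
    (h : A ^ κ ≤ K * (D ^ α * B ^ β + F ^ γ)) :
    A.toReal ^ κ ≤ K * D.toReal ^ α * B.toReal ^ β + K * F.toReal ^ γ := by
  have hDB : D ^ α * B ^ β ≠ ⊤ := ENNReal.mul_ne_top (ENNReal.rpow_ne_top_of_nonneg hα hD)
    (ENNReal.rpow_ne_top_of_nonneg hβ hB)
  have hF' : F ^ γ ≠ ⊤ := ENNReal.rpow_ne_top_of_nonneg hγ hF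
  calc A.toReal ^ κ ≤ (K * (D ^ α * B ^ β + F ^ γ)).toReal := by
        rw [ENNReal.toReal_rpow]
        exact ENNReal.toReal_mono
          (ENNReal.mul_ne_top ENNReal.coe_ne_top (ENNReal.add_ne_top.2 ⟨hDB, hF'⟩)) h
    _ = _ := by
        rw [ENNReal.toReal_mul, ENNReal.toReal_add hDB hF', ENNReal.toReal_mul,
          ← ENNReal.toReal_rpow, ← ENNReal.toReal_rpow, ← ENNReal.toReal_rpow,
          ENNReal.coe_toReal, mul_add, mul_assoc]

theorem theorem1p1_general (hE : finrank ℝ E = N) (hN : 2 ≤ N) (ha₀ : 0 ≤ a) (ha₁ : a < 1)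
    (hθ : 0 ≤ θ) :
    ∃ C : ℝ, 0 < C ∧ ∀ r : ℝ, N ≤ r → r ≤ N / (1 - a) → ∀ u : E → ℝ, ContDiff ℝ 1 u →
      HasCompactSupport u → tsupport u ⊆ {x | 1 < ‖x‖} →
      (∫ x in {x | 1 < ‖x‖}, ‖x‖ ^ (-((N : ℝ) + θ)) * |u x| ^ r ∂μ) ^ (1 / r) ≤
        C * (∫ x in {x | 1 < ‖x‖}, ‖fderiv ℝ u x‖ ^ (N : ℝ) ∂μ) ^ (a / N) *
            (∫ x in {x | 1 < ‖x‖}, ‖x‖ ^ (-((N : ℝ) + θ)) * |u x| ^ (N : ℝ) ∂μ) ^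
              ((1 - a) / N) +
          C * (∫ x in {x | 1 < ‖x‖}, ‖x‖ ^ (-((N : ℝ) + θ * (1 - a))) * |u x| ^ (N : ℝ) ∂μ) ^
            (1 / (N : ℝ)) := by
  have hN₀ : 0 < (N : ℝ) := by positivity
  have ha : 0 ≤ 1 - a := sub_nonneg.2 ha₁.le
  obtain ⟨K, hK₀, hK⟩ := exists_exterior_lintegral_rpow_inv_le μ hE hN ha₀ ha₁ hθ
  refine ⟨K, hK₀, fun r hNr hr u hu hcu hu_supp => ?_⟩
  have hr₀ : 0 < r := hN₀.trans_le hNr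
  have hσ : -((N : ℝ) + θ) ≤ 0 := neg_nonpos.2 (by positivity)
  have hδ : -((N : ℝ) + θ * (1 - a)) ≤ 0 := neg_nonpos.2 (add_nonneg hN₀.le (mul_nonneg hθ ha))
  have hu_ext := (subset_tsupport u).trans hu_supp
  have hDu := hu.continuous_fderiv one_ne_zero
  have hDu_ext := (support_fderiv_subset ℝ).trans hu_supp
  have gradient_integral : ∫ x in {x | 1 < ‖x‖}, ‖fderiv ℝ u x‖ ^ (N : ℝ) ∂μ =
      (∫⁻ x, ‖fderiv ℝ u x‖ₑ ^ (N : ℝ) ∂μ).toReal := by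
    simpa [powerWeight_zero] using setIntegral_exterior_rpow_mul (μ := μ) 0 hN₀ hDu hDu_ext
  have gradient_finite : ∫⁻ x, ‖fderiv ℝ u x‖ₑ ^ (N : ℝ) ∂μ ≠ ⊤ := by
    simpa only [powerWeight_zero] using
      lintegral_powerWeight_exterior_ne_top (μ := μ) le_rfl hN₀ hDu (hcu.fderiv ℝ) hDu_ext
  simp only [← Real.norm_eq_abs]
  rw [gradient_integral, setIntegral_exterior_rpow_mul _ hr₀ hu.continuous hu_ext,
    setIntegral_exterior_rpow_mul _ hN₀ hu.continuous hu_ext,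
    setIntegral_exterior_rpow_mul _ hN₀ hu.continuous hu_ext]
  exact toReal_le_mul_rpow_add_of_le (by positivity) (by positivity) (by positivity)
    gradient_finite (lintegral_powerWeight_exterior_ne_top hσ hN₀ hu.continuous hcu hu_ext)
    (lintegral_powerWeight_exterior_ne_top hδ hN₀ hu.continuous hcu hu_ext)
    (hK r hNr hr u hu hcu hu_ext)

end Exterior

theorem theorem1p1 (N : ℕ) (hN : 2 ≤ N) (a θ δ : ℝ) (ha₀ : 0 < a) (ha₁ : a < 1) (hθ : 0 < θ)
    (hδ : δ = -((N : ℝ) + θ * (1 - a))) :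
    ∃ C : ℝ, 0 < C ∧ ∀ r : ℝ, (N : ℝ) < r → r ≤ (N : ℝ) / (1 - a) →
      ∀ u : EuclideanSpace ℝ (Fin N) → ℝ, IsTestFunction (exteriorUnitBall N) u →
        (∫ x in exteriorUnitBall N, ‖x‖ ^ (-((N : ℝ) + θ)) * |u x| ^ r) ^ (1 / r) ≤
          C * (∫ x in exteriorUnitBall N, ‖∇ u x‖ ^ (N : ℝ)) ^ (a / (N : ℝ)) *
              (∫ x in exteriorUnitBall N, ‖x‖ ^ (-((N : ℝ) + θ)) * |u x| ^ (N : ℝ)) ^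
                ((1 - a) / (N : ℝ)) +
            C * (∫ x in exteriorUnitBall N, ‖x‖ ^ δ * |u x| ^ (N : ℝ)) ^ (1 / (N : ℝ)) := by
  obtain ⟨C, hC₀, hC⟩ := theorem1p1_general volume finrank_euclideanSpace_fin hN ha₀.le ha₁ hθ.le
  refine ⟨C, hC₀, fun r hNr hr u hu => ?_⟩
  subst hδ
  simpa only [exteriorUnitBall, gradient, LinearIsometryEquiv.norm_map] using hC r hNr.le hr u
    (hu.smooth.of_le (by simp)) hu.compact_support hu.support_subset
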